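/- **One-dimensional operators.** For an integer $n>2$ consider three kinds $\alpha\in\{1,2,3\}$ of discrete Laplacians on $(0,1)$ with $2^n$ unknowns, $L_{n,\alpha}=h_\alpha^{-2}A_{n,\alpha}\in\mathbb R^{2^n\times 2^n}$: (1, Dirichlet) $h_1=\frac1{2^n+1}$, and $A_{n,1}$ is tridiagonal with $-2$ on the diagonal and $1$ on the two adjacent diagonals; (2, periodic) $h_2=\frac1{2^n}$, and $A_{n,2}$ is $A_{n,1}$ with additional entries $1$ in the upper right and lower left corners; (3, Neumann/Robin, with parameters $a_0,a_1\in\mathbb R$) $h_3=\frac1{2^n-1}$, and $A_{n,3}$ is $A_{n,1}$ with the first row replaced by $(-2+2a_0h_3,\,2,\,0,\dots,0)$ and the last row by $(0,\dots,0,\,2,\,-2-2a_1h_3)$. Put $L_1=5$, $L_2=3$, $L_3=10$. **Theorem.** For each $\alpha$ and each $n>2$ there are unitaries $R_{\alpha,1},\dots,R_{\alpha,L_\alpha}\in U(2^n)$, depending only on $\alpha$ and $n$ (not on the Robin parameters), and real numbers $c_{\alpha,j}$ (depending on $\alpha$, $n$ and, for $\alpha=3$, on $a_0,a_1$; they may vanish)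 with $A_{n,\alpha}=\sum_{j=1}^{L_\alpha}c_{\alpha,j}R_{\alpha,j}$, and there is an absolute constant $K$, such that the following holds. Let $d\ge2$, let $\mathbf n=(n_1,\dots,n_d)$ with integers $n_i>2$, $n^*=\max_i n_i$, and let $\boldsymbol\alpha=(\alpha_1,\dots,\alpha_d)$ with $\alpha_i\in\{1,2,3\}$ (each direction with $\alpha_i=3$ having its own real parameters $a_0,a_1$). Then the Laplacian on the box $(0,1)^d$, $$L^d_{\mathbf n,\boldsymbol\alpha}=\sum_{i=1}^d I^{\otimes n_d}\otimes\cdots\otimes I^{\otimes n_{i+1}}\otimes L_{n_i,\alpha_i}\otimes I^{\otimes n_{i-1}}\otimes\cdots\otimes I^{\otimes n_1},$$ satisfies $$L^d_{\mathbf n,\boldsymbol\alpha}=\sum_{i=1}^d\sum_{j=1}^{L_{\alpha_i}}c^i_{\alpha_i,j}R^i_{\alpha_i,j},\qquad c^i_{\alpha_i,j}=\frac{c_{\alpha_i,j}}{h_{\alpha_i}^2}\in\mathbb R,\qquad R^i_{\alpha_i,j}=I^{\otimes n_d}\otimes\cdots\otimes I^{\otimes n_{i+1}}\otimes R_{\alpha_i,j}\otimes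 I^{\otimes n_{i-1}}\otimes\cdots\otimes I^{\otimes n_1},$$ where $h_{\alpha_i}$, $c_{\alpha_i,j}$ and $R_{\alpha_i,j}$ are taken for $n=n_i$ (and the parameters of direction $i$). Here $L_{\alpha_i}\le10$, so that there are at most $10d$ terms, and each $R^i_{\alpha_i,j}$ is unitary. Moreover, each $R^i_{\alpha_i,j}$ is exactly the operator of a circuit on the $n_1+\dots+n_d$ qubits of the register, without any ancilla, that consists of at most one $Z$ gate, at most two Hadamard gates, and at most $K\,n^*$ Toffoli, $X$ and CNOT gates in total. -/

import Mathlib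

namespace PoissonLCU

/-! ### Tensor (Kronecker) products

The row and column indices of a `d`-fold tensor product are the multi-indices. -/

/-- The Kronecker product of a finite family of square matrices, indexed by multi-indices. -/
def kron {ι : Type*} [Fintype ι] {κ : ι → Type*} (M : ∀ i, Matrix (κ i) (κ i) ℂ) :
    Matrix (∀ i, κ i) (∀ i, κ i) ℂ :=
  fun x y => ∏ i, M i (x i) (y i)

/-- `I ⊗ ⋯ ⊗ I ⊗ M ⊗ I ⊗ ⋯ ⊗ I`, with the matrix `M` acting on the factor `i`. -/
def atSite {ι : Type*} [Fintype ι] [DecidableEq ι] {κ : ι → Type*} [∀ i, DecidableEq (κ i)]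
    (i : ι) (M : Matrix (κ i) (κ i) ℂ) : Matrix (∀ i, κ i) (∀ i, κ i) ℂ :=
  kron (Function.update (β := fun k => Matrix (κ k) (κ k) ℂ) (fun _ => 1) i M)

/-! ### The discrete Laplacians -/

/-- The three kinds of one-dimensional operators. -/
inductive BoundaryKind
  | dirichlet
  | periodic
  | robin

/-- A boundary condition on `(0,1)`.  `robin a₀ a₁` stands for `u'(0) + a₀ u(0) = b₀` and
`u'(1) + a₁ u(1) = b₁`; the value `0` of a parameter is a Neumann condition at that endpoint. -/
inductive BoundaryOp
  | dirichlet
  | periodic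
  | robin (a₀ a₁ : ℝ)

/-- The kind of a boundary condition (it forgets the Robin parameters). -/
def BoundaryOp.kind : BoundaryOp → BoundaryKind
  | .dirichlet => .dirichlet
  | .periodic => .periodic
  | .robin _ _ => .robin

/-- The mesh size for `2 ^ n` unknowns. -/
noncomputable def meshSize (n : ℕ) : BoundaryKind → ℝ
  | .dirichlet => 1 / (2 ^ n + 1)
  | .periodic => 1 / 2 ^ n
  | .robin => 1 / (2 ^ n - 1)

/-- The tridiagonal stencil with `-2` on the diagonal and `1` next to it. -/
def dirichletStencil (n : ℕ) : Matrix (Fin (2 ^ n)) (Fin (2 ^ n)) ℝ := fun i j =>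
  if i = j then -2
  else if (i : ℕ) + 1 = j ∨ (j : ℕ) + 1 = i then 1
  else 0

/-- The stencil with additional entries `1` in the upper right and lower left corners. -/
def periodicStencil (n : ℕ) : Matrix (Fin (2 ^ n)) (Fin (2 ^ n)) ℝ := fun i j =>
  if i = j then -2
  else if (i : ℕ) + 1 = j ∨ (j : ℕ) + 1 = i then 1
  else if ((i : ℕ) = 0 ∧ (j : ℕ) + 1 = 2 ^ n) ∨ ((j : ℕ) = 0 ∧ (i : ℕ) + 1 = 2 ^ n) then 1
  else 0

/-- The Neumann/Robin stencil: first row `(-2 + 2 a₀ h, 2, 0, …, 0)`, last row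
`(0, …, 0, 2, -2 - 2 a₁ h)`, and `(…, 1, -2, 1, …)` in between. -/
noncomputable def robinStencil (n : ℕ) (a₀ a₁ : ℝ) : Matrix (Fin (2 ^ n)) (Fin (2 ^ n)) ℝ :=
  fun i j =>
    if i = j then
      if (i : ℕ) = 0 then -2 + 2 * a₀ * meshSize n .robin
      else if (i : ℕ) + 1 = 2 ^ n then -2 - 2 * a₁ * meshSize n .robin
      else -2
    else if (i : ℕ) + 1 = j then
      if (i : ℕ) = 0 then 2 else 1
    else if (j : ℕ) + 1 = i then
      if (i : ℕ) + 1 = 2 ^ n then 2 else 1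
    else 0

/-- The stencil matrix of a boundary condition. -/
noncomputable def stencil (n : ℕ) : BoundaryOp → Matrix (Fin (2 ^ n)) (Fin (2 ^ n)) ℝ
  | .dirichlet => dirichletStencil n
  | .periodic => periodicStencil n
  | .robin a₀ a₁ => robinStencil n a₀ a₁

/-- The one-dimensional discrete Laplacian `L_{n,α} = h⁻² · stencil`, as a complex matrix. -/
noncomputable def laplacian1D (n : ℕ) (α : BoundaryOp) :
    Matrix (Fin (2 ^ n)) (Fin (2 ^ n)) ℂ :=
  ((1 / meshSize n α.kind ^ 2) • stencil n α).map ((↑) : ℝ → ℂ)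

/-- The normalized one-dimensional matrix `A_{n,α} = h² · L_{n,α}`. -/
noncomputable def normalized1D (n : ℕ) (α : BoundaryOp) :
    Matrix (Fin (2 ^ n)) (Fin (2 ^ n)) ℂ :=
  ((meshSize n α.kind ^ 2 : ℝ) : ℂ) • laplacian1D n α

/-- The `d`-dimensional discrete Laplacian on the grid with `2 ^ n i` points in direction `i`:
the Kronecker sum of the one-dimensional operators `L_{n i, α i}`. -/
noncomputable def laplacian {d : ℕ} (n : Fin d → ℕ) (α : Fin d → BoundaryOp) :
    Matrix (∀ i, Fin (2 ^ n i)) (∀ i, Fin (2 ^ n i)) ℂ :=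
  ∑ i, atSite i (laplacian1D (n i) (α i))

/-! ### Quantum circuits -/

/-- The elementary gates on a register whose qubits are labelled by `Q`. -/
inductive Gate (Q : Type)
  | X (t : Q)
  | Z (t : Q)
  | H (t : Q)
  | CNOT (c t : Q) (hct : c ≠ t)
  | Toffoli (c₁ c₂ t : Q) (hcc : c₁ ≠ c₂) (hct₁ : c₁ ≠ t) (hct₂ : c₂ ≠ t)

/-- The Pauli `X` matrix. -/
def pauliX : Matrix (Fin 2) (Fin 2) ℂ := !![0, 1; 1, 0]

/-- The Pauli `Z` matrix. -/
def pauliZ : Matrix (Fin 2) (Fin 2) ℂ := !![1, 0; 0, -1]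

/-- The Hadamard matrix. -/
noncomputable def hadamard : Matrix (Fin 2) (Fin 2) ℂ :=
  ((1 / Real.sqrt 2 : ℝ) : ℂ) • !![1, 1; 1, -1]

/-- The `2 × 2` matrix `U` applied to the qubit `t`, on computational basis states `Q → Fin 2`. -/
def onQubit {Q : Type} [Fintype Q] [DecidableEq Q] (t : Q) (U : Matrix (Fin 2) (Fin 2) ℂ) :
    Matrix (Q → Fin 2) (Q → Fin 2) ℂ :=
  atSite (κ := fun _ : Q => Fin 2) t U

/-- The matrix of a gate; a controlled gate acts as `X` on its target if all its controls are `1`,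
and as the identity otherwise. -/
noncomputable def Gate.matrix {Q : Type} [Fintype Q] [DecidableEq Q] :
    Gate Q → Matrix (Q → Fin 2) (Q → Fin 2) ℂ
  | .X t => onQubit t pauliX
  | .Z t => onQubit t pauliZ
  | .H t => onQubit t hadamard
  | .CNOT c t _ => fun x y =>
      if y c = 1 then onQubit t pauliX x y else (1 : Matrix (Q → Fin 2) (Q → Fin 2) ℂ) x y
  | .Toffoli c₁ c₂ t _ _ _ => fun x y =>
      if y c₁ = 1 ∧ y c₂ = 1 then onQubit t pauliX x y
      else (1 : Matrix (Q → Fin 2) (Q → Fin 2) ℂ) x y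

/-- Is the gate a `Z` gate? -/
def Gate.isZ {Q : Type} : Gate Q → Bool
  | .Z _ => true
  | _ => false

/-- Is the gate a Hadamard gate? -/
def Gate.isH {Q : Type} : Gate Q → Bool
  | .H _ => true
  | _ => false

/-- Is the gate an `X`, a `CNOT` or a Toffoli gate? -/
def Gate.isClassical {Q : Type} : Gate Q → Bool
  | .X _ => true
  | .CNOT _ _ _ => true
  | .Toffoli _ _ _ _ _ _ => true
  | _ => false

/-- A circuit is a list of gates, in the order of the matrix product. -/
abbrev Circuit (Q : Type) := List (Gate Q)

/-- The operator that a circuit performs. -/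
noncomputable def Circuit.matrix {Q : Type} [Fintype Q] [DecidableEq Q] (C : Circuit Q) :
    Matrix (Q → Fin 2) (Q → Fin 2) ℂ :=
  (C.map Gate.matrix).prod

/-- The number of `Z` gates. -/
def Circuit.numZ {Q : Type} (C : Circuit Q) : ℕ := C.countP Gate.isZ

/-- The number of Hadamard gates. -/
def Circuit.numH {Q : Type} (C : Circuit Q) : ℕ := C.countP Gate.isH

/-- The total number of `X`, `CNOT` and Toffoli gates. -/
def Circuit.numClassical {Q : Type} (C : Circuit Q) : ℕ := C.countP Gate.isClassical

/-- `n` qubits encode the numbers below `2 ^ n` in binary, the qubit `0` being the most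
significant one. -/
def binary (n : ℕ) : (Fin n → Fin 2) ≃ Fin (2 ^ n) :=
  (Equiv.arrowCongr Fin.revPerm (Equiv.refl (Fin 2))).trans finFunctionFinEquiv

/-- The qubits of the register: `n i` of them for the direction `i`, and no others. -/
abbrev Qubits {d : ℕ} (n : Fin d → ℕ) : Type := Σ i, Fin (n i)

/-- Computational basis states of the register correspond to grid multi-indices. -/
def basisEquiv {d : ℕ} (n : Fin d → ℕ) : (Qubits n → Fin 2) ≃ (∀ i, Fin (2 ^ n i)) :=
  (Equiv.piCurry (fun (i : Fin d) (_ : Fin (n i)) => Fin 2)).trans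
    (Equiv.piCongrRight fun i => binary (n i))

/-- The circuit `C`, which acts on the `n 0 + ⋯ + n (d - 1)` qubits of the register and uses no
ancilla, performs exactly the operator `U`. -/
def Implements {d : ℕ} {n : Fin d → ℕ} (C : Circuit (Qubits n))
    (U : Matrix (∀ i, Fin (2 ^ n i)) (∀ i, Fin (2 ^ n i)) ℂ) : Prop :=
  Matrix.reindex (basisEquiv n) (basisEquiv n) C.matrix = U

/-- The number of terms `L_α` for each kind of one-dimensional operator. -/
def numTerms : BoundaryKind → ℕ
  | .dirichlet => 5
  | .periodic => 3
  | .robin => 10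

end PoissonLCU

open PoissonLCU

/-! Let `S` be the cyclic shift, and let `F₀`, `F₁` be the diagonal reflections that flip the sign
of the first and of the last basis vector. Identity, `S` and its transpose give the periodic
stencil. Multiplying by a reflection flips the sign of a single row or column, so half-sums with `S`
remove the corner entry (Dirichlet), and combinations with `F₀` and `F₁` also double an off-diagonal
boundary entry (Robin); diagonal boundary terms come from `F₀` and `F₁` themselves. This is
`normalized1D_eq_sum`. No term contains more than one reflection.

It remains to implement `S` and `F₁` with linearly many gates and no ancilla. Since `d ≥ 2`, the
other directions provide qubits that may be borrowed: they start in an arbitrary state and must be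
restored. A ripple-carry adder (`exists_adder`) adds a borrowed number plus a carry. Adding with one
carry and subtracting with another leaves only the difference of the carries
(`exists_adds_of_flips`), which gives an increment when as many qubits can be borrowed as the
register has. For a full register, each half is borrowed to increment the other, so three outside
qubits suffice (`exists_increment`).

An increment on all qubits followed by a decrement on all but the top one is a multiply controlled
`X` (`Adds.flips`). Hadamard gates on its target turn it into `F₁` (`Flips.matrix_hadamard_conj`),
and conjugation by `S` gives `F₀`. Hence two Hadamard gates suffice and no `Z` gate is used. -/

namespace PoissonLCU

/-! ### Reversible circuits acting on binary numbers -/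

section Reversible

open Function

variable {Q : Type}

/-- All gates of the circuit are `X`, `CNOT` or Toffoli gates. -/
def Circuit.Reversible (C : Circuit Q) : Prop := ∀ g ∈ C, g.isClassical = true

theorem Circuit.Reversible.append {C D : Circuit Q} (hC : Circuit.Reversible C)
    (hD : Circuit.Reversible D) : Circuit.Reversible (C ++ D) := by
  intro g hg
  rcases List.mem_append.1 hg with h | h
  exacts [hC g h, hD g h]

theorem Circuit.Reversible.reverse {C : Circuit Q} (hC : Circuit.Reversible C) :
    Circuit.Reversible C.reverse :=
  fun g hg => hC g (List.mem_reverse.1 hg)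

/-- The number that a list of qubits encodes in binary, least significant qubit first. -/
def val : List Q → (Q → Fin 2) → ℤ
  | [], _ => 0
  | q :: l, f => ((f q : ℕ) : ℤ) + 2 * val l f

theorem val_congr {l : List Q} {f g : Q → Fin 2} (h : ∀ q ∈ l, f q = g q) :
    val l f = val l g := by
  induction l with
  | nil => rfl
  | cons q l ih => simp_all [val]

theorem val_append (l m : List Q) (f : Q → Fin 2) :
    val (l ++ m) f = val l f + 2 ^ l.length * val m f := by
  induction l with
  | nil => simp [val]
  | cons q l ih => simp only [List.cons_append, val, ih, List.length_cons]; ring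

theorem val_nonneg (l : List Q) (f : Q → Fin 2) : 0 ≤ val l f := by
  induction l with
  | nil => simp [val]
  | cons q l ih => simp only [val]; positivity

theorem val_lt (l : List Q) (f : Q → Fin 2) : val l f < 2 ^ l.length := by
  induction l with
  | nil => simp [val]
  | cons q l ih =>
    have := (f q).isLt
    simp only [val, List.length_cons, pow_succ]
    omega

theorem eq_of_val_eq {l : List Q} {f g : Q → Fin 2} (h : val l f = val l g) :
    ∀ q ∈ l, f q = g q := by
  induction l with
  | nil => simp
  | cons q l ih =>
    have h1 := (f q).isLt
    have h2 := (g q).isLt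
    simp only [val] at h
    have h3 : val l f = val l g := by omega
    have h4 : f q = g q := Fin.ext (by omega)
    simpa [h4] using ih h3

/-- Circuits are specified by congruences modulo a power of two; this recovers equality from bounds.
-/
theorem eq_of_dvd_sub {N a b : ℤ} (ha : 0 ≤ a) (ha' : a < N) (hb : 0 ≤ b) (hb' : b < N)
    (h : N ∣ a - b) : a = b := by
  have := Int.eq_zero_of_abs_lt_dvd h (by rw [abs_lt]; constructor <;> linarith)
  linarith

/-- `1` if all qubits of the list are `1`, and `0` otherwise. -/
def allOnes (l : List Q) (f : Q → Fin 2) : Fin 2 := if ∀ q ∈ l, f q = 1 then 1 else 0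

theorem val_eq_max_iff (l : List Q) (f : Q → Fin 2) :
    val l f = 2 ^ l.length - 1 ↔ ∀ q ∈ l, f q = 1 := by
  induction l with
  | nil => simp [val]
  | cons q l ih =>
    have h1 := val_lt l f
    have h2 := (f q).isLt
    rw [List.forall_mem_cons, ← ih, val, List.length_cons, pow_succ, Fin.ext_iff, Fin.val_one]
    omega

variable [DecidableEq Q]

/-- The action of a classical gate on computational basis states. -/
def Gate.act : Gate Q → (Q → Fin 2) → (Q → Fin 2)
  | .X t, f => update f t (f t + 1)
  | .CNOT c t _, f => update f t (f t + f c)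
  | .Toffoli c₁ c₂ t _ _ _, f => update f t (f t + f c₁ * f c₂)
  | .Z _, f => f
  | .H _, f => f

/-- The action of a classical circuit on computational basis states; the last gate of the list
acts first. -/
def Circuit.run (C : Circuit Q) (f : Q → Fin 2) : Q → Fin 2 := C.foldr Gate.act f

theorem Circuit.run_append (C D : Circuit Q) (f : Q → Fin 2) :
    Circuit.run (C ++ D) f = Circuit.run C (Circuit.run D f) := by
  simp [Circuit.run]

theorem Gate.act_act (g : Gate Q) (f : Q → Fin 2) : g.act (g.act f) = f := by
  have h : ∀ a b : Fin 2, a + b + b = a := by decide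
  cases g with
  | X t => simp [Gate.act, h]
  | Z t => rfl
  | H t => rfl
  | CNOT c t hct => simp [Gate.act, h, update_of_ne hct]
  | Toffoli c₁ c₂ t h₁ h₂ h₃ => simp [Gate.act, h, update_of_ne h₂, update_of_ne h₃]

/-- Every gate acts as an involution, so inverting a circuit only means reversing the list.
Subtraction is thus a reversed addition. -/
theorem Circuit.run_reverse_run (C : Circuit Q) (f : Q → Fin 2) :
    Circuit.run C.reverse (Circuit.run C f) = f := by
  induction C generalizing f with
  | nil => rfl
  | cons g C ih =>
    rw [List.reverse_cons, Circuit.run_append]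
    have : Circuit.run [g] (Circuit.run (g :: C) f) = Circuit.run C f :=
      Gate.act_act g _
    rw [this, ih]

theorem Circuit.run_run_reverse (C : Circuit Q) (f : Q → Fin 2) :
    Circuit.run C (Circuit.run C.reverse f) = f := by
  simpa using Circuit.run_reverse_run C.reverse f

theorem eq_of_val_modEq {l : List Q} {f g : Q → Fin 2} (hoff : ∀ q ∉ l, f q = g q)
    (h : (2 : ℤ) ^ l.length ∣ val l f - val l g) : f = g := by
  have := eq_of_val_eq
    (eq_of_dvd_sub (val_nonneg l f) (val_lt l f) (val_nonneg l g) (val_lt l g) h)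
  funext q
  by_cases hq : q ∈ l
  exacts [this q hq, hoff q hq]

/-- The circuit adds `a` to the number in the register `l`, modulo `2 ^ l.length`, and does not
change any other qubit. -/
structure Adds (C : Circuit Q) (l : List Q) (a : (Q → Fin 2) → ℤ) : Prop where
  unchanged : ∀ f, ∀ q ∉ l, Circuit.run C f q = f q
  dvd : ∀ f, (2 : ℤ) ^ l.length ∣ val l (Circuit.run C f) - (val l f + a f)

theorem Adds.unchanged_reverse {C : Circuit Q} {l : List Q} {a : (Q → Fin 2) → ℤ} (h : Adds C l a)
    (f : Q → Fin 2) : ∀ q ∉ l, Circuit.run C.reverse f q = f q := by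
  intro q hq
  have := h.unchanged (Circuit.run C.reverse f) q hq
  rw [Circuit.run_run_reverse] at this
  exact this.symm

theorem Adds.dvd_reverse {C : Circuit Q} {l : List Q} {a : (Q → Fin 2) → ℤ} (h : Adds C l a)
    (f : Q → Fin 2) : (2 : ℤ) ^ l.length ∣
      val l f - (val l (Circuit.run C.reverse f) + a (Circuit.run C.reverse f)) := by
  have := h.dvd (Circuit.run C.reverse f)
  rwa [Circuit.run_run_reverse] at this

/-! ### Linear-size addition and increment with borrowed qubits -/

/-- A ripple-carry adder with carry-in qubit `c` and without ancillas: it adds the number in the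
second components, and the carry, to the number in the first components. -/
theorem exists_adder (l : List (Q × Q)) (c : Q)
    (hl : (c :: (l.map Prod.fst ++ l.map Prod.snd)).Nodup) :
    ∃ C : Circuit Q, Circuit.Reversible C ∧ C.length ≤ 6 * l.length ∧
      Adds C (l.map Prod.fst) (fun f => val (l.map Prod.snd) f + ((f c : ℕ) : ℤ)) := by
  induction l generalizing c with
  | nil => exact ⟨[], by simp [Circuit.Reversible], by simp,
      ⟨fun f q _ => rfl, fun f => by simp⟩⟩
  | cons p l ih =>
    obtain ⟨x, y⟩ := p
    simp only [List.map_cons, List.cons_append, List.nodup_cons, List.mem_cons, List.mem_append,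
      List.nodup_append, not_or] at hl
    obtain ⟨⟨hcx, hc1, hcy, hc2⟩, ⟨hx1, hxy, hx2⟩, hn1, ⟨hy2, hn2⟩, hd⟩ := hl
    have hy1 : y ∉ l.map Prod.fst := fun h => hd y h y (Or.inl rfl) rfl
    obtain ⟨D, hD, hDl, hA⟩ := ih y (by
      simp only [List.nodup_cons, List.mem_append, List.nodup_append, not_or]
      exact ⟨⟨hy1, hy2⟩, hn1, hn2, fun a ha b hb => hd a ha b (Or.inr hb)⟩)
    -- The last gate acts first. `pre` leaves the carry, the majority of `x`, `y`, `c`, in `y`,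
    -- which is the carry-in for the remaining bits. `post` then restores `y` and `c` and leaves the
    -- sum bit in `x`.
    let pre : Circuit Q := [.Toffoli c x y hcx hcy hxy, .CNOT y c (Ne.symm hcy),
      .CNOT y x (Ne.symm hxy)]
    let post : Circuit Q := [.CNOT c x hcx, .CNOT y c (Ne.symm hcy),
      .Toffoli c x y hcx hcy hxy]
    have hpre : ∀ f, Circuit.run pre f x = f x + f y ∧ Circuit.run pre f c = f c + f y ∧
        Circuit.run pre f y = f y + (f c + f y) * (f x + f y) ∧
        ∀ q, q ≠ x → q ≠ c → q ≠ y → Circuit.run pre f q = f q := by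
      intro f
      simp +contextual [pre, Circuit.run, Gate.act, hcx, hcy, hxy, Ne.symm hcx,
        Ne.symm hcy, Ne.symm hxy]
    have hpost : ∀ f, Circuit.run post f y = f y + f c * f x ∧
        Circuit.run post f c = f c + (f y + f c * f x) ∧
        Circuit.run post f x = f x + (f c + (f y + f c * f x)) ∧
        ∀ q, q ≠ x → q ≠ c → q ≠ y → Circuit.run post f q = f q := by
      intro f
      simp +contextual [post, Circuit.run, Gate.act, hcx, hcy, hxy, Ne.symm hcx,
        Ne.symm hcy, Ne.symm hxy]
    refine ⟨post ++ D ++ pre, ?_, ?_, ?_, ?_⟩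
    · refine Circuit.Reversible.append (Circuit.Reversible.append ?_ hD) ?_ <;>
        simp [Circuit.Reversible, pre, post, Gate.isClassical]
    · simp [pre, post]; omega
    · intro f q hq
      simp only [List.map_cons, List.mem_cons, not_or] at hq
      rw [Circuit.run_append, Circuit.run_append]
      obtain ⟨p1, p2, p3, p4⟩ := hpre f
      obtain ⟨s1, s2, s3, s4⟩ := hpost (Circuit.run D (Circuit.run pre f))
      by_cases hqc : q = c
      · subst hqc
        rw [s2, hA.unchanged _ _ hc1, hA.unchanged _ _ hx1, hA.unchanged _ _ hy1, p1, p2, p3]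
        generalize f x = a, f y = b, f q = d
        revert a b d; decide
      by_cases hqy : q = y
      · subst hqy
        rw [s1, hA.unchanged _ _ hc1, hA.unchanged _ _ hx1, hA.unchanged _ _ hy1, p1, p2, p3]
        generalize f x = a, f q = b, f c = d
        revert a b d; decide
      · rw [s4 q hq.1 hqc hqy, hA.unchanged _ _ hq.2, p4 q hq.1 hqc hqy]
    · intro f
      rw [Circuit.run_append, Circuit.run_append]
      obtain ⟨p1, p2, p3, p4⟩ := hpre f
      obtain ⟨s1, s2, s3, s4⟩ := hpost (Circuit.run D (Circuit.run pre f))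
      obtain ⟨k, hk⟩ := hA.dvd (Circuit.run pre f)
      have e1 : val (l.map Prod.fst) (Circuit.run post (Circuit.run D (Circuit.run pre f))) =
          val (l.map Prod.fst) (Circuit.run D (Circuit.run pre f)) :=
        val_congr fun q hq => s4 q (fun h => hx1 (h ▸ hq)) (fun h => hc1 (h ▸ hq))
          (fun h => hy1 (h ▸ hq))
      have e2 : val (l.map Prod.fst) (Circuit.run pre f) = val (l.map Prod.fst) f :=
        val_congr fun q hq => p4 q (fun h => hx1 (h ▸ hq)) (fun h => hc1 (h ▸ hq))
          (fun h => hy1 (h ▸ hq))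
      have e3 : val (l.map Prod.snd) (Circuit.run pre f) = val (l.map Prod.snd) f :=
        val_congr fun q hq => p4 q (fun h => hx2 (h ▸ hq)) (fun h => hc2 (h ▸ hq))
          (fun h => hy2 (h ▸ hq))
      rw [e2, e3, p3] at hk
      rw [hA.unchanged _ _ hc1, hA.unchanged _ _ hx1, hA.unchanged _ _ hy1, p1, p2, p3] at s3
      simp only [List.map_cons, val, List.length_cons, e1, s3]
      refine ⟨k, ?_⟩
      -- The full-adder identity: sum bit plus twice the carry equals the sum of the three input
      -- bits.
      have key : ∀ a b d : Fin 2,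
          ((a + b + (d + b + (b + (d + b) * (a + b) + (d + b) * (a + b))) : Fin 2) : ℕ) +
            2 * ((b + (d + b) * (a + b) : Fin 2) : ℕ) = (a : ℕ) + (b : ℕ) + (d : ℕ) := by decide
      have key' := congrArg (Nat.cast : ℕ → ℤ) (key (f x) (f y) (f c))
      push_cast at key'
      rw [pow_succ]
      linear_combination 2 * hk + key'

/-- Controlled on `b`, every bit is complemented. Complementation reverses the order of the numbers,
so conjugation by it exchanges addition and subtraction. -/
theorem exists_fanout (b : Q) (l : List Q) (hb : b ∉ l) (hl : l.Nodup) :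
    ∃ C : Circuit Q, Circuit.Reversible C ∧ C.length ≤ l.length ∧
      (∀ f, ∀ q ∉ l, Circuit.run C f q = f q) ∧
      ∀ f, val l (Circuit.run C f) =
        if f b = 1 then 2 ^ l.length - 1 - val l f else val l f := by
  induction l with
  | nil => exact ⟨[], by simp [Circuit.Reversible], by simp, fun f q _ => rfl,
      fun f => by simp [val]⟩
  | cons x l ih =>
    simp only [List.mem_cons, not_or, List.nodup_cons] at hb hl
    obtain ⟨C, hC, hCl, hoff, hon⟩ := ih hb.2 hl.2
    have hrun : ∀ f, Circuit.run (.CNOT b x hb.1 :: C) f =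
        update (Circuit.run C f) x (f x + f b) := by
      intro f
      change update (Circuit.run C f) x (Circuit.run C f x + Circuit.run C f b) = _
      rw [hoff f x hl.1, hoff f b hb.2]
    refine ⟨.CNOT b x hb.1 :: C, ?_, by simpa using hCl, ?_, ?_⟩
    · intro g hg
      rcases List.mem_cons.1 hg with rfl | h
      exacts [rfl, hC g h]
    · intro f q hq
      simp only [List.mem_cons, not_or] at hq
      rw [hrun, update_of_ne hq.1, hoff f q hq.2]
    · intro f
      have e : val l (Circuit.run (.CNOT b x hb.1 :: C) f) = val l (Circuit.run C f) := by
        rw [hrun]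
        exact val_congr fun q hq => update_of_ne (fun h : q = x => hl.1 (h ▸ hq)) _ _
      rw [val, e, hrun, update_self, hon, val, List.length_cons]
      have key : ∀ a : Fin 2, ((a + 1 : Fin 2) : ℕ) + (a : ℕ) = 1 := by decide
      have key' := congrArg (Nat.cast : ℕ → ℤ) (key (f x))
      push_cast at key'
      by_cases h : f b = 1
      · simp only [h, if_true, pow_succ]
        linear_combination key'
      · have h0 : f b = 0 := by
          have := (f b).isLt
          omega
        simp [h0]

/-- The circuit flips the qubit `t` if `a = 1`, and does nothing else. -/
def Flips (C : Circuit Q) (t : Q) (a : (Q → Fin 2) → Fin 2) : Prop :=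
  ∀ f, Circuit.run C f = update f t (f t + a f)

/-- Given a circuit that flips a borrowed qubit `b` if `a = 1`, the number in a register can be
increased by `a` with as many further borrowed qubits as the register has. -/
theorem exists_adds_of_flips {M : Circuit Q} {b : Q} {a : (Q → Fin 2) → Fin 2}
    (hM : Circuit.Reversible M) (hMb : Flips M b a) (xs ys : List Q)
    (ha : ∀ f g : Q → Fin 2, (∀ q, q ∉ xs → q ≠ b → f q = g q) → a f = a g)
    (hn : (b :: (xs ++ ys)).Nodup) (hlen : xs.length ≤ ys.length) :
    ∃ C : Circuit Q, Circuit.Reversible C ∧ C.length ≤ 14 * xs.length + 2 * M.length ∧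
      Adds C xs (fun f => ((a f : ℕ) : ℤ)) := by
  have hn' := hn
  simp only [List.nodup_cons, List.mem_append, not_or, List.nodup_append] at hn'
  obtain ⟨⟨hb1, hb2⟩, hx, hy, hxy⟩ := hn'
  obtain ⟨F, hF, hFl, hFoff, hFon⟩ := exists_fanout b xs hb1 hx
  let zs := ys.take xs.length
  have hzl : zs.length = xs.length := by simp [zs, hlen]
  have h1 : (xs.zip zs).map Prod.fst = xs := List.map_fst_zip hzl.ge
  have h2 : (xs.zip zs).map Prod.snd = zs := List.map_snd_zip hzl.le
  have hsub : ∀ q ∈ zs, q ∈ ys := fun q hq => List.mem_of_mem_take hq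
  obtain ⟨D, hD, hDl, hA⟩ := exists_adder (xs.zip zs) b (by
    rw [h1, h2]
    exact hn.sublist (((List.take_sublist _ _).append_left _).cons_cons _))
  rw [h1, h2] at hA
  have hl : (xs.zip zs).length = xs.length := by simp [hzl]
  have hz : ∀ q ∈ zs, q ∉ xs ∧ q ≠ b := fun q hq =>
    ⟨fun h => hxy q h q (hsub q hq) rfl, fun h => hb2 (h ▸ hsub q hq)⟩
  -- Read from the right: `D` adds `zs` with carry `b + a` modulo 2, and after `b` is restored
  -- `D.reverse` subtracts `zs` with carry `b`. The net change is `a` if `b = 0` and `-a` if `b =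
  -- 1`; the outer `F` corrects the sign in the second case.
  refine ⟨F ++ (D.reverse ++ (M ++ (D ++ (M ++ F)))), ?_, ?_, ?_⟩
  · exact hF.append (hD.reverse.append (hM.append (hD.append (hM.append hF))))
  · simp only [List.length_append, List.length_reverse]; omega
  have hstep : ∀ f, let f₁ := Circuit.run F f
      let f₂ := Circuit.run M f₁
      let f₃ := Circuit.run D f₂
      let f₄ := Circuit.run M f₃
      let f₅ := Circuit.run D.reverse f₄
      (∀ q ∉ xs, f₅ q = f q) ∧
      (2 : ℤ) ^ xs.length ∣ val xs f₅ - (val xs f₁ + ((f b + a f : Fin 2) : ℕ) - (f b : ℕ)) := by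
    intro f f₁ f₂ f₃ f₄ f₅
    have e1 : ∀ q ∉ xs, f₁ q = f q := hFoff f
    have a1 : a f₁ = a f := ha _ _ fun q hq _ => e1 q hq
    have e2 : f₂ = update f₁ b (f b + a f) := by
      rw [← a1, ← e1 b hb1]; exact hMb f₁
    have e3 : ∀ q ∉ xs, f₃ q = f₂ q := hA.unchanged f₂
    have a3 : a f₃ = a f := ha _ _ fun q hq hqb => by
      rw [e3 q hq, e2, update_of_ne hqb, e1 q hq]
    have b3 : f₃ b = f b + a f := by rw [e3 b hb1, e2, update_self]
    have e4 : f₄ = update f₃ b (f b) := by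
      have : f₄ = update f₃ b (f₃ b + a f₃) := hMb f₃
      rw [this, b3, a3]
      have key : ∀ u v : Fin 2, u + v + v = u := by decide
      rw [key]
    have e5 : ∀ q ∉ xs, f₅ q = f₄ q := hA.unchanged_reverse f₄
    have e6 : ∀ q ∉ xs, f₅ q = f q := by
      intro q hq
      rw [e5 q hq, e4]
      by_cases hqb : q = b
      · rw [hqb, update_self]
      · rw [update_of_ne hqb, e3 q hq, e2, update_of_ne hqb, e1 q hq]
    refine ⟨e6, ?_⟩
    obtain ⟨k, hk⟩ := hA.dvd f₂
    obtain ⟨k', hk'⟩ := hA.dvd_reverse f₄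
    have v2 : val xs f₂ = val xs f₁ := val_congr fun q hq => by
      rw [e2, update_of_ne (fun h : q = b => hb1 (h ▸ hq))]
    have v4 : val xs f₄ = val xs f₃ := val_congr fun q hq => by
      rw [e4, update_of_ne (fun h : q = b => hb1 (h ▸ hq))]
    have z2 : val zs f₂ = val zs f := val_congr fun q hq => by
      rw [e2, update_of_ne (hz q hq).2, e1 q (hz q hq).1]
    have z5 : val zs f₅ = val zs f := val_congr fun q hq => e6 q (hz q hq).1
    have b2 : f₂ b = f b + a f := by rw [e2, update_self]
    change val xs f₃ - _ = _ at hk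
    change _ - (val xs f₅ + (val zs f₅ + ((f₅ b : ℕ) : ℤ))) = _ at hk'
    rw [v2, z2, b2] at hk
    rw [v4, z5, e6 b hb1] at hk'
    exact ⟨k - k', by linear_combination hk - hk'⟩
  constructor
  · intro f q hq
    simp only [Circuit.run_append]
    rw [hFoff _ q hq, (hstep f).1 q hq]
  · intro f
    simp only [Circuit.run_append]
    obtain ⟨hoff, k, hk⟩ := hstep f
    rw [hFon, hoff b hb1]
    rw [hFon] at hk
    have hcase : ∀ u : Fin 2, u = 0 ∨ u = 1 := by decide
    rcases hcase (f b) with h0 | h1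
    · simp only [h0, zero_add, Fin.isValue, zero_ne_one, if_false, Fin.val_zero, Nat.cast_zero]
        at hk ⊢
      exact ⟨k, by linear_combination hk⟩
    · simp only [h1, if_true] at hk ⊢
      have key : ∀ u : Fin 2, ((1 + u : Fin 2) : ℕ) + (u : ℕ) = 1 := by decide
      have key' := congrArg (Nat.cast : ℕ → ℤ) (key (a f))
      push_cast at key'
      simp only [Fin.val_one, Nat.cast_one] at hk
      exact ⟨-k, by linear_combination -hk - key'⟩

theorem exists_increment_of_borrowed (xs ys : List Q) (b : Q) (hn : (b :: (xs ++ ys)).Nodup)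
    (hlen : xs.length ≤ ys.length) :
    ∃ C : Circuit Q, Circuit.Reversible C ∧ C.length ≤ 14 * xs.length + 2 ∧
      Adds C xs (fun _ => 1) := by
  obtain ⟨C, hC, hl, h⟩ := exists_adds_of_flips (M := [Gate.X b]) (b := b) (a := fun _ => 1)
    (by simp [Circuit.Reversible, Gate.isClassical]) (fun f => rfl) xs ys (fun _ _ _ => rfl) hn hlen
  exact ⟨C, hC, by simpa using hl, by simpa using h⟩

/-- Incrementing `l` together with a new most significant qubit `t` and then decrementing `l`
flips `t` if all qubits of `l` are `1`. -/
theorem Adds.flips {C D : Circuit Q} {l : List Q} {t : Q} (ht : t ∉ l)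
    (hC : Adds C (l ++ [t]) (fun _ => 1)) (hD : Adds D l (fun _ => 1)) :
    Flips (D.reverse ++ C) t (allOnes l) := by
  intro f
  rw [Circuit.run_append]
  have h1 := hD.unchanged_reverse (Circuit.run C f)
  obtain ⟨k, hk⟩ := hD.dvd_reverse (Circuit.run C f)
  obtain ⟨k', hk'⟩ := hC.dvd f
  simp only [val_append, List.length_append, List.length_singleton, val, pow_succ, mul_zero,
    add_zero] at hk'
  have hv : val l (Circuit.run D.reverse (Circuit.run C f)) = val l f := by
    refine eq_of_dvd_sub (val_nonneg _ _) (val_lt _ _) (val_nonneg _ _) (val_lt _ _)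
      ⟨2 * k' + (f t : ℕ) - (Circuit.run C f t : ℕ) - k, ?_⟩
    linear_combination hk' - hk
  have hl := eq_of_val_eq hv
  funext q
  by_cases hq : q ∈ l
  · rw [hl q hq, update_of_ne (fun h : q = t => ht (h ▸ hq))]
  rw [h1 q hq]
  by_cases hqt : q = t
  · subst hqt
    rw [update_self]
    rw [hv] at hk
    have b1 := val_nonneg l (Circuit.run C f)
    have b2 := val_lt l (Circuit.run C f)
    have b3 := val_lt l f
    have b4 := val_nonneg l f
    have b5 := (Circuit.run C f q).isLt
    have b6 := (f q).isLt
    have hmax := val_eq_max_iff l f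
    set N : ℤ := 2 ^ l.length
    unfold allOnes
    -- The increment carries into `t` exactly when the number in `l` is maximal.
    by_cases hall : ∀ q ∈ l, f q = 1
    · rw [if_pos hall]
      have e : val l f = N - 1 := hmax.2 hall
      have e0 : val l (Circuit.run C f) = 0 := by
        refine eq_of_dvd_sub b1 b2 le_rfl (by omega) ⟨k + 1, ?_⟩
        rw [e] at hk
        linear_combination hk
      rw [e, e0] at hk'
      have hN : N ≠ 0 := by omega
      have h3 : ((Circuit.run C f q : ℕ) : ℤ) - (f q : ℕ) - 1 = 2 * k' :=
        mul_left_cancel₀ hN (by linear_combination hk')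
      generalize Circuit.run C f q = u at *
      generalize f q = v at *
      apply Fin.ext
      rw [Fin.val_add, Fin.val_one]
      omega
    · rw [if_neg hall, add_zero]
      have e : val l f ≠ N - 1 := fun h => hall (hmax.1 h)
      have e0 : val l (Circuit.run C f) = val l f + 1 :=
        eq_of_dvd_sub b1 b2 (by omega) (by omega) ⟨k, hk⟩
      rw [e0] at hk'
      have hN : N ≠ 0 := by omega
      have h3 : ((Circuit.run C f q : ℕ) : ℤ) - (f q : ℕ) = 2 * k' :=
        mul_left_cancel₀ hN (by linear_combination hk')
      apply Fin.ext
      omega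
  · rw [update_of_ne hqt, hC.unchanged f q (by simp [hq, hqt])]

/-- An increment of any register needs only linearly many gates and three borrowed qubits. -/
theorem exists_increment (xs : List Q) (b e₁ e₂ : Q) (hn : (b :: e₁ :: e₂ :: xs).Nodup) :
    ∃ C : Circuit Q, Circuit.Reversible C ∧ C.length ≤ 100 * (xs.length + 1) ∧
      Adds C xs (fun _ => 1) := by
  -- `l` is the low half and `u` the high half, which may be longer by one qubit; `e₁` makes up for
  -- the difference when `u` borrows `l`.
  obtain ⟨l, u, rfl, h1, h2⟩ : ∃ l u : List Q, xs = l ++ u ∧ l.length ≤ u.length ∧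
      u.length ≤ l.length + 1 := by
    refine ⟨xs.take (xs.length / 2), xs.drop (xs.length / 2),
      (List.take_append_drop _ _).symm, ?_, ?_⟩ <;> simp <;> omega
  simp only [List.nodup_cons, List.mem_cons, List.mem_append, not_or, List.nodup_append] at hn
  obtain ⟨⟨hbe1, hbe2, hbl, hbu⟩, ⟨he12, he1l, he1u⟩, ⟨he2l, he2u⟩, hl, hu, hlu⟩ := hn
  obtain ⟨C₁, hC₁, hC₁l, hA₁⟩ := exists_increment_of_borrowed (l ++ [b]) (u ++ [e₁]) e₂ (by
    simp only [List.nodup_cons, List.mem_append, List.nodup_append, List.mem_singleton]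
    grind) (by simp; omega)
  obtain ⟨C₂, hC₂, hC₂l, hA₂⟩ := exists_increment_of_borrowed l u e₂ (by
    simp only [List.nodup_cons, List.mem_append, List.nodup_append]
    grind) h1
  -- The carry out of `l` is flipped into the borrowed `b` and added to `u`. It depends only on `l`,
  -- so borrowing `l` as the addend is harmless.
  obtain ⟨C₃, hC₃, hC₃l, hA₃⟩ := exists_adds_of_flips (hC₂.reverse.append hC₁)
    (Adds.flips hbl hA₁ hA₂) u (l ++ [e₁]) (by
      intro f g h
      unfold allOnes
      refine if_congr (forall₂_congr fun q hq => ?_) rfl rfl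
      rw [h q (fun hq' => hlu q hq q hq' rfl) (fun hqb => hbl (hqb ▸ hq))]) (by
    simp only [List.nodup_cons, List.mem_append, List.nodup_append, List.mem_singleton]
    grind) (by simpa using h2)
  -- `C₃` acts first, because the carry must be read off before `l` is incremented.
  refine ⟨C₂ ++ C₃, hC₂.append hC₃, ?_, ?_, ?_⟩
  · simp only [List.length_append, List.length_reverse, List.length_singleton] at *
    omega
  · intro f q hq
    simp only [List.mem_append, not_or] at hq
    rw [Circuit.run_append, hA₂.unchanged _ q hq.1, hA₃.unchanged _ q hq.2]
  · intro f
    rw [Circuit.run_append]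
    have hlu' : ∀ q ∈ u, q ∉ l := fun q hq hq' => hlu q hq' q hq rfl
    have hv : val u (Circuit.run C₂ (Circuit.run C₃ f)) = val u (Circuit.run C₃ f) :=
      val_congr fun q hq => hA₂.unchanged _ q (hlu' q hq)
    have hv' : val l (Circuit.run C₃ f) = val l f :=
      val_congr fun q hq => hA₃.unchanged _ q (fun h => hlu' q h hq)
    obtain ⟨k, hk⟩ := hA₂.dvd (Circuit.run C₃ f)
    obtain ⟨k', hk'⟩ := hA₃.dvd f
    rw [val_append, val_append, hv, List.length_append, pow_add]
    have b1 := val_nonneg l (Circuit.run C₂ (Circuit.run C₃ f))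
    have b2 := val_lt l (Circuit.run C₂ (Circuit.run C₃ f))
    have b3 := val_lt l f
    have b4 := val_nonneg l f
    have hmax := val_eq_max_iff l f
    rw [hv'] at hk
    set N : ℤ := 2 ^ l.length
    unfold allOnes at hk'
    by_cases hall : ∀ q ∈ l, f q = 1
    · rw [if_pos hall] at hk'
      have e : val l f = N - 1 := hmax.2 hall
      have e0 : val l (Circuit.run C₂ (Circuit.run C₃ f)) = 0 := by
        refine eq_of_dvd_sub b1 b2 le_rfl (by omega) ⟨k + 1, ?_⟩
        rw [e] at hk
        linear_combination hk
      rw [e, e0]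
      simp only [Fin.val_one, Nat.cast_one] at hk'
      exact ⟨k', by linear_combination N * hk'⟩
    · rw [if_neg hall] at hk'
      have e : val l f ≠ N - 1 := fun h => hall (hmax.1 h)
      have e0 : val l (Circuit.run C₂ (Circuit.run C₃ f)) = val l f + 1 :=
        eq_of_dvd_sub b1 b2 (by omega) (by omega) ⟨k, hk⟩
      rw [e0]
      simp only [Fin.val_zero, Nat.cast_zero] at hk'
      exact ⟨k', by linear_combination N * hk'⟩

end Reversible

/-! ### Operators on one tensor factor -/

section Kron

variable {ι : Type*} [Fintype ι] {κ : ι → Type*}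

theorem kron_mul [DecidableEq ι] [∀ i, Fintype (κ i)] (M N : ∀ i, Matrix (κ i) (κ i) ℂ) :
    kron M * kron N = kron (fun i => M i * N i) := by
  ext x y
  simp only [kron, Matrix.mul_apply, Finset.prod_univ_sum, Fintype.piFinset_univ,
    Finset.prod_mul_distrib]

variable [DecidableEq ι] [∀ i, DecidableEq (κ i)]

theorem atSite_apply (i : ι) (M : Matrix (κ i) (κ i) ℂ) (x y : ∀ i, κ i) :
    atSite i M x y = if ∀ k, k ≠ i → x k = y k then M (x i) (y i) else 0 := by
  rw [atSite, kron, ← Finset.mul_prod_erase _ _ (Finset.mem_univ i), Function.update_self]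
  have h : ∀ k ∈ Finset.univ.erase i,
      Function.update (β := fun k => Matrix (κ k) (κ k) ℂ) (fun _ => 1) i M k (x k) (y k) =
        if x k = y k then 1 else 0 := by
    intro k hk
    rw [Function.update_of_ne (Finset.ne_of_mem_erase hk), Matrix.one_apply]
  rw [Finset.prod_congr rfl h, Finset.prod_boole]
  simp

theorem atSite_mul [∀ i, Fintype (κ i)] (i : ι) (M N : Matrix (κ i) (κ i) ℂ) :
    atSite i (M * N) = atSite i M * atSite i N := by
  rw [atSite, atSite, atSite, kron_mul]
  congr 1
  funext k
  by_cases hk : k = i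
  · subst hk; simp
  · simp [Function.update_of_ne hk]

theorem atSite_one (i : ι) : atSite i (1 : Matrix (κ i) (κ i) ℂ) = 1 := by
  ext x y
  rw [atSite_apply, Matrix.one_apply, Matrix.one_apply, ← ite_and]
  refine if_congr ⟨fun h => funext fun k => ?_, fun h => ?_⟩ rfl rfl
  · by_cases hk : k = i
    · exact hk ▸ h.2
    · exact h.1 k hk
  · subst h; simp

theorem atSite_transpose (i : ι) (M : Matrix (κ i) (κ i) ℂ) :
    (atSite i M).transpose = atSite i M.transpose := by
  ext x y
  simp only [Matrix.transpose_apply, atSite_apply, eq_comm]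

theorem atSite_conjTranspose (i : ι) (M : Matrix (κ i) (κ i) ℂ) :
    (atSite i M).conjTranspose = atSite i M.conjTranspose := by
  ext x y
  simp only [Matrix.conjTranspose_apply, atSite_apply, eq_comm, apply_ite star, star_zero]

theorem atSite_mem_unitaryGroup [∀ i, Fintype (κ i)] {i : ι} {M : Matrix (κ i) (κ i) ℂ}
    (hM : M ∈ Matrix.unitaryGroup (κ i) ℂ) :
    atSite i M ∈ Matrix.unitaryGroup (∀ i, κ i) ℂ := by
  rw [Matrix.mem_unitaryGroup_iff, Matrix.star_eq_conjTranspose] at hM ⊢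
  rw [atSite_conjTranspose, ← atSite_mul, hM, atSite_one]

theorem atSite_smul (i : ι) (a : ℂ) (M : Matrix (κ i) (κ i) ℂ) :
    atSite i (a • M) = a • atSite i M := by
  ext x y
  simp [atSite_apply]

theorem atSite_sum {J : Type*} (s : Finset J) (i : ι) (M : J → Matrix (κ i) (κ i) ℂ) :
    atSite i (∑ j ∈ s, M j) = ∑ j ∈ s, atSite i (M j) := by
  ext x y
  rw [atSite_apply, Matrix.sum_apply, Matrix.sum_apply]
  simp only [atSite_apply]
  split_ifs <;> simp

end Kron

/-! ### Matrices of circuits -/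

section CircuitMatrix

open Function Matrix

variable {Q : Type} [Fintype Q] [DecidableEq Q]

theorem onQubit_pauliX_apply (t : Q) (x y : Q → Fin 2) :
    onQubit t pauliX x y = if x = update y t (y t + 1) then 1 else 0 := by
  have key : ∀ u v : Fin 2, pauliX u v = if u = v + 1 then 1 else 0 := by
    intro u v
    fin_cases u <;> fin_cases v <;> simp [pauliX]
  rw [onQubit, atSite_apply, key, ← ite_and]
  exact if_congr (and_comm.trans eq_update_iff.symm) rfl rfl

theorem Gate.matrix_apply_of_isClassical {g : Gate Q} (hg : g.isClassical = true)
    (x y : Q → Fin 2) : g.matrix x y = if x = g.act y then 1 else 0 := by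
  have h2 : ∀ a : Fin 2, a ≠ 1 → a = 0 := by decide
  have h3 : ∀ a b : Fin 2, ¬ (a = 1 ∧ b = 1) → a * b = 0 := by decide
  cases g with
  | X t => exact onQubit_pauliX_apply t x y
  | Z t => simp [Gate.isClassical] at hg
  | H t => simp [Gate.isClassical] at hg
  | CNOT c t hct =>
    simp only [Gate.matrix, Gate.act, onQubit_pauliX_apply]
    by_cases h : y c = 1
    · simp [h]
    · simp [h2 _ h, Matrix.one_apply]
  | Toffoli c₁ c₂ t _ _ _ =>
    simp only [Gate.matrix, Gate.act, onQubit_pauliX_apply]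
    by_cases h : y c₁ = 1 ∧ y c₂ = 1
    · simp [h]
    · simp [if_neg h, h3 _ _ h, Matrix.one_apply]

theorem Circuit.matrix_append (C D : Circuit Q) :
    Circuit.matrix (C ++ D) = Circuit.matrix C * Circuit.matrix D := by
  simp [Circuit.matrix]

theorem Circuit.Reversible.matrix_apply {C : Circuit Q} (hC : Circuit.Reversible C)
    (x y : Q → Fin 2) : Circuit.matrix C x y = if x = Circuit.run C y then 1 else 0 := by
  induction C generalizing x with
  | nil => exact (Matrix.one_apply (i := x) (j := y)).trans (if_congr Iff.rfl rfl rfl)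
  | cons g C ih =>
    have hg := Gate.matrix_apply_of_isClassical (hC g (by simp))
    have : Circuit.matrix (g :: C) = g.matrix * Circuit.matrix C := by simp [Circuit.matrix]
    rw [this, Matrix.mul_apply]
    have ih' := fun z => ih (fun g' h => hC g' (by simp [h])) z
    rw [Finset.sum_eq_single (Circuit.run C y) (fun z _ hz => by rw [ih', if_neg hz, mul_zero])
      (by simp), ih', if_pos rfl, mul_one, hg]
    exact if_congr Iff.rfl rfl rfl

/-- The matrix is a permutation matrix, whose inverse is its transpose. -/
theorem Circuit.Reversible.matrix_reverse {C : Circuit Q} (hC : Circuit.Reversible C) :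
    Circuit.matrix C.reverse = (Circuit.matrix C).transpose := by
  ext x y
  rw [Matrix.transpose_apply, hC.matrix_apply, hC.reverse.matrix_apply]
  refine if_congr ⟨?_, ?_⟩ rfl rfl
  · rintro rfl; rw [Circuit.run_run_reverse]
  · rintro rfl; rw [Circuit.run_reverse_run]

theorem onQubit_mul (t : Q) (U V : Matrix (Fin 2) (Fin 2) ℂ) :
    onQubit t (U * V) = onQubit t U * onQubit t V :=
  atSite_mul (κ := fun _ : Q => Fin 2) t U V

theorem onQubit_one (t : Q) : onQubit t 1 = 1 :=
  atSite_one (κ := fun _ : Q => Fin 2) t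

theorem onQubit_pauliZ (t : Q) :
    onQubit t pauliZ = diagonal fun x => if x t = 1 then -1 else 1 := by
  have key : ∀ u v : Fin 2, pauliZ u v = if u = v then (if u = 1 then -1 else 1) else 0 := by
    intro u v
    fin_cases u <;> fin_cases v <;> simp [pauliZ]
  ext x y
  rw [onQubit, atSite_apply, key, ← ite_and, diagonal_apply]
  refine if_congr ⟨fun h => funext fun k => ?_, fun h => ?_⟩ rfl rfl
  · by_cases hk : k = t
    · exact hk ▸ h.2
    · exact h.1 k hk
  · subst h; simp

theorem hadamard_mul_self : hadamard * hadamard = 1 := by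
  have h : ((1 / Real.sqrt 2 : ℝ) : ℂ) * ((1 / Real.sqrt 2 : ℝ) : ℂ) = 1 / 2 := by
    rw [← Complex.ofReal_mul, div_mul_div_comm, Real.mul_self_sqrt (by norm_num)]
    simp
  rw [hadamard, smul_mul_smul_comm, h]
  ext u v
  fin_cases u <;> fin_cases v <;> norm_num [Matrix.mul_apply]

theorem hadamard_mul_pauliX_mul_hadamard : hadamard * pauliX * hadamard = pauliZ := by
  have h : ((1 / Real.sqrt 2 : ℝ) : ℂ) * ((1 / Real.sqrt 2 : ℝ) : ℂ) = 1 / 2 := by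
    rw [← Complex.ofReal_mul, div_mul_div_comm, Real.mul_self_sqrt (by norm_num)]
    simp
  rw [hadamard, smul_mul_assoc, smul_mul_smul_comm, h]
  ext u v
  fin_cases u <;> fin_cases v <;> norm_num [Matrix.mul_apply, pauliX, pauliZ]

/-- The diagonal entries do not depend on the qubit `t`, so the two factors act on different qubits.
-/
theorem onQubit_mul_diagonal_comm {t : Q} {p : (Q → Fin 2) → ℂ}
    (hp : ∀ x y : Q → Fin 2, (∀ k, k ≠ t → x k = y k) → p x = p y)
    (U : Matrix (Fin 2) (Fin 2) ℂ) :
    onQubit t U * diagonal p = diagonal p * onQubit t U := by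
  ext x y
  rw [mul_diagonal, diagonal_mul, onQubit, atSite_apply]
  split_ifs with h
  · rw [hp x y h, mul_comm]
  · simp

/-- Conjugating a multiply controlled `X` by Hadamard gates on the target gives a reflection. -/
theorem Flips.matrix_hadamard_conj {C : Circuit Q} (hC : Circuit.Reversible C) {l : List Q} {t : Q}
    (ht : t ∉ l) (hf : Flips C t (allOnes l)) :
    Circuit.matrix ([Gate.H t] ++ C ++ [Gate.H t]) =
      diagonal fun x => if ∀ q ∈ l ++ [t], x q = 1 then -1 else 1 := by
  set p : (Q → Fin 2) → ℂ := fun x => if ∀ q ∈ l, x q = 1 then 1 else 0 with hpdef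
  have hp : ∀ x y : Q → Fin 2, (∀ k, k ≠ t → x k = y k) → p x = p y := fun x y h =>
    if_congr (forall₂_congr fun q hq => by rw [h q fun e => ht (e ▸ hq)]) rfl rfl
  -- With `p` the projection onto "all controls are `1`", the Hadamard gates commute past `p`; they
  -- cancel on its complement and turn `X` into `Z` on its range.
  have hCm : Circuit.matrix C = (1 - diagonal p) + onQubit t pauliX * diagonal p := by
    ext x y
    rw [hC.matrix_apply, hf y, Matrix.add_apply, Matrix.sub_apply, mul_diagonal,
      onQubit_pauliX_apply, diagonal_apply, allOnes, Matrix.one_apply]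
    by_cases h : ∀ q ∈ l, y q = 1
    · by_cases hxy : x = y
      · subst hxy; simp [hpdef, if_pos h]
      · simp [hpdef, if_pos h, hxy]
    · by_cases hxy : x = y
      · subst hxy; simp [hpdef, if_neg h]
      · simp [hpdef, if_neg h, hxy]
  have hH : Circuit.matrix [Gate.H t] = onQubit t hadamard := by
    simp [Circuit.matrix, Gate.matrix]
  rw [Circuit.matrix_append, Circuit.matrix_append, hH, hCm]
  have e : onQubit t hadamard * (1 - diagonal p + onQubit t pauliX * diagonal p) *
      onQubit t hadamard = onQubit t (hadamard * hadamard) * (1 - diagonal p) +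
        onQubit t (hadamard * pauliX * hadamard) * diagonal p := by
    simp only [onQubit_mul, mul_add, add_mul, mul_sub, sub_mul, mul_one, mul_assoc,
      ← onQubit_mul_diagonal_comm hp hadamard]
  rw [e, hadamard_mul_self, hadamard_mul_pauliX_mul_hadamard, onQubit_one, onQubit_pauliZ,
    one_mul, diagonal_mul_diagonal, ← diagonal_one, diagonal_sub, diagonal_add]
  congr 1
  funext x
  by_cases h : ∀ q ∈ l, x q = 1
  · by_cases h' : x t = 1
    · have : ∀ q ∈ l ++ [t], x q = 1 := by simpa [or_imp, forall_and, h'] using h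
      simp only [hpdef, if_pos h, if_pos h', if_pos this]; ring
    · have : ¬ ∀ q ∈ l ++ [t], x q = 1 := fun hq => h' (hq t (by simp))
      simp only [hpdef, if_pos h, if_neg h', if_neg this]; ring
  · have : ¬ ∀ q ∈ l ++ [t], x q = 1 := fun hq => h fun q h' => hq q (by simp [h'])
    simp only [hpdef, if_neg h, if_neg this]; ring

end CircuitMatrix

/-! ### Shifts, reflections and the one-dimensional decompositions -/

section Terms

/-- The cyclic shift `|y⟩ ↦ |y + 1 mod 2 ^ m⟩`. -/
def shift (m : ℕ) : Matrix (Fin (2 ^ m)) (Fin (2 ^ m)) ℂ := fun x y =>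
  if (y : ℕ) + 1 = x ∨ ((x : ℕ) = 0 ∧ (y : ℕ) + 1 = 2 ^ m) then 1 else 0

/-- The reflection that flips the sign of `|0⟩`. -/
def reflFirst (m : ℕ) : Matrix (Fin (2 ^ m)) (Fin (2 ^ m)) ℂ :=
  Matrix.diagonal fun x => if (x : ℕ) = 0 then -1 else 1

/-- The reflection that flips the sign of `|2 ^ m - 1⟩`. -/
def reflLast (m : ℕ) : Matrix (Fin (2 ^ m)) (Fin (2 ^ m)) ℂ :=
  Matrix.diagonal fun x => if (x : ℕ) + 1 = 2 ^ m then -1 else 1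

theorem shift_mul_transpose (m : ℕ) : shift m * (shift m).transpose = 1 := by
  ext x y
  have hx := x.isLt
  have hy := y.isLt
  rw [Matrix.mul_apply, Matrix.one_apply]
  simp only [shift, Matrix.transpose_apply]
  by_cases h : (x : ℕ) = 0
  · rw [Finset.sum_eq_single ⟨2 ^ m - 1, by omega⟩ _ (by simp)]
    · simp only [Fin.ext_iff]
      split_ifs <;> first | omega | simp
    · intro z _ hz
      rw [ne_eq, Fin.ext_iff] at hz
      have := z.isLt
      rw [if_neg (by grind), zero_mul]
  · rw [Finset.sum_eq_single ⟨x - 1, by omega⟩ _ (by simp)]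
    · simp only [Fin.ext_iff]
      split_ifs <;> first | omega | simp
    · intro z _ hz
      rw [ne_eq, Fin.ext_iff] at hz
      rw [if_neg (by grind), zero_mul]

/-- The shift maps the last basis vector to the first, so only one of the two reflections needs its
own circuit. -/
theorem reflFirst_eq (m : ℕ) : reflFirst m = shift m * reflLast m * (shift m).transpose := by
  have h : reflFirst m * shift m = shift m * reflLast m := by
    ext x y
    rw [reflFirst, reflLast, Matrix.diagonal_mul, Matrix.mul_diagonal, shift]
    have := y.isLt
    split_ifs <;> first | omega | simp
  rw [← h, mul_assoc, shift_mul_transpose, mul_one]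

theorem shift_conjTranspose (m : ℕ) : (shift m).conjTranspose = (shift m).transpose := by
  ext x y
  simp only [shift, Matrix.conjTranspose_apply, Matrix.transpose_apply, apply_ite star,
    star_one, star_zero]

theorem shift_mem_unitaryGroup (m : ℕ) : shift m ∈ Matrix.unitaryGroup (Fin (2 ^ m)) ℂ := by
  rw [Matrix.mem_unitaryGroup_iff, Matrix.star_eq_conjTranspose, shift_conjTranspose,
    shift_mul_transpose]

theorem shift_transpose_mem_unitaryGroup (m : ℕ) :
    (shift m).transpose ∈ Matrix.unitaryGroup (Fin (2 ^ m)) ℂ := by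
  rw [← shift_conjTranspose, ← Matrix.star_eq_conjTranspose]
  exact Unitary.star_mem (shift_mem_unitaryGroup m)

theorem reflLast_mem_unitaryGroup (m : ℕ) :
    reflLast m ∈ Matrix.unitaryGroup (Fin (2 ^ m)) ℂ := by
  rw [Matrix.mem_unitaryGroup_iff, Matrix.star_eq_conjTranspose, reflLast,
    Matrix.diagonal_conjTranspose, Matrix.diagonal_mul_diagonal, ← Matrix.diagonal_one]
  congr 1
  funext x
  by_cases h : (x : ℕ) + 1 = 2 ^ m <;> simp [h]

theorem reflFirst_mem_unitaryGroup (m : ℕ) :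
    reflFirst m ∈ Matrix.unitaryGroup (Fin (2 ^ m)) ℂ := by
  rw [reflFirst_eq]
  exact mul_mem (mul_mem (shift_mem_unitaryGroup m) (reflLast_mem_unitaryGroup m))
    (shift_transpose_mem_unitaryGroup m)

/-- The unitaries of the decompositions of the one-dimensional operators. -/
def lcuUnitary : ∀ (k : BoundaryKind) (m : ℕ),
    Fin (numTerms k) → Matrix (Fin (2 ^ m)) (Fin (2 ^ m)) ℂ
  | .dirichlet, m => ![1, shift m, reflFirst m * shift m, (shift m).transpose,
      (shift m).transpose * reflFirst m]
  | .periodic, m => ![1, shift m, (shift m).transpose]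
  | .robin, m => ![1, shift m, reflFirst m * shift m, reflLast m * shift m,
      (shift m).transpose, (shift m).transpose * reflFirst m,
      reflFirst m * (shift m).transpose, reflFirst m, reflLast m, 1]

/-- The coefficients of the decompositions of the one-dimensional operators. -/
noncomputable def lcuCoeff : ∀ (b : BoundaryOp) (_ : ℕ), Fin (numTerms b.kind) → ℝ
  | .dirichlet, _ => ![-2, 1 / 2, 1 / 2, 1 / 2, 1 / 2]
  | .periodic, _ => ![-2, 1, 1]
  | .robin a₀ a₁, m => ![-2 + a₀ * meshSize m .robin - a₁ * meshSize m .robin, 1, 1 / 2, -1 / 2,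
      1, 1 / 2, -1 / 2, -(a₀ * meshSize m .robin), a₁ * meshSize m .robin, 0]

theorem lcuUnitary_mem_unitaryGroup (k : BoundaryKind) (m : ℕ) (j : Fin (numTerms k)) :
    lcuUnitary k m j ∈ Matrix.unitaryGroup (Fin (2 ^ m)) ℂ := by
  have hS := shift_mem_unitaryGroup m
  have hT := shift_transpose_mem_unitaryGroup m
  have h0 := reflFirst_mem_unitaryGroup m
  have h1 := reflLast_mem_unitaryGroup m
  have hI := one_mem (Matrix.unitaryGroup (Fin (2 ^ m)) ℂ)
  cases k <;> fin_cases j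
  exacts [hI, hS, mul_mem h0 hS, hT, mul_mem hT h0, hI, hS, hT, hI, hS, mul_mem h0 hS,
    mul_mem h1 hS, hT, mul_mem hT h0, mul_mem h0 hT, h0, h1, hI]

theorem meshSize_ne_zero {m : ℕ} (hm : 2 < m) (k : BoundaryKind) : meshSize m k ≠ 0 := by
  have h : (1 : ℝ) < 2 ^ m := one_lt_pow₀ (by norm_num) (by omega)
  cases k <;> simp only [meshSize] <;> apply ne_of_gt <;> apply one_div_pos.2 <;> linarith

theorem normalized1D_eq {m : ℕ} (hm : 2 < m) (b : BoundaryOp) :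
    normalized1D m b = (stencil m b).map ((↑) : ℝ → ℂ) := by
  have h := meshSize_ne_zero hm b.kind
  ext x y
  simp only [normalized1D, laplacian1D, Matrix.smul_apply, Matrix.map_apply, smul_eq_mul]
  rw [← Complex.ofReal_mul]
  congr 1
  field_simp

/-- In the Robin case `S + F₀ S / 2 - F₁ S / 2` has weight `1` on interior rows, `0` on the row of
the wrap-around entry and `2` on the last row. For the transpose, `F₀` on the right removes the
corner and on the left doubles the entry of the first row. The diagonal parameters enter with half
their size, since a reflection changes a sign by two. The tenth Robin term is padding with
coefficient `0`. -/
theorem normalized1D_eq_sum {m : ℕ} (hm : 2 < m) (b : BoundaryOp) :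
    normalized1D m b = ∑ j, (lcuCoeff b m j : ℂ) • lcuUnitary b.kind m j := by
  -- The bound keeps corners and neighbouring entries apart, so that `omega` can discard the
  -- inconsistent index cases.
  have hN : 8 ≤ 2 ^ m := by
    calc 8 = 2 ^ 3 := by norm_num
      _ ≤ 2 ^ m := Nat.pow_le_pow_right (by norm_num) hm
  rw [normalized1D_eq hm]
  cases b with
  | dirichlet =>
    change _ = ∑ j : Fin 5, _
    ext x y
    have hx := x.isLt
    have hy := y.isLt
    rw [Matrix.map_apply, Matrix.sum_apply]
    simp only [Fin.sum_univ_succ, stencil, dirichletStencil, lcuCoeff, lcuUnitary, shift, reflFirst,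
      Matrix.smul_apply, Matrix.mul_diagonal, Matrix.diagonal_mul, Matrix.transpose_apply,
      Matrix.one_apply, Fin.ext_iff, BoundaryOp.kind, Matrix.cons_val_zero, Matrix.cons_val_succ,
      Finset.univ_eq_empty, Finset.sum_empty, smul_eq_mul]
    generalize (x : ℕ) = a at *
    generalize (y : ℕ) = b at *
    generalize 2 ^ m = N at *
    split_ifs <;> first | (exfalso; omega) | (push_cast; ring)
  | periodic =>
    change _ = ∑ j : Fin 3, _
    ext x y
    have hx := x.isLt
    have hy := y.isLt
    rw [Matrix.map_apply, Matrix.sum_apply]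
    simp only [Fin.sum_univ_succ, stencil, periodicStencil, lcuCoeff, lcuUnitary, shift,
      Matrix.smul_apply, Matrix.transpose_apply,
      Matrix.one_apply, Fin.ext_iff, BoundaryOp.kind, Matrix.cons_val_zero, Matrix.cons_val_succ,
      Finset.univ_eq_empty, Finset.sum_empty, smul_eq_mul]
    generalize (x : ℕ) = a at *
    generalize (y : ℕ) = b at *
    generalize 2 ^ m = N at *
    split_ifs <;> first | (exfalso; omega) | (push_cast; ring)
  | robin a₀ a₁ =>
    change _ = ∑ j : Fin 10, _
    ext x y
    have hx := x.isLt
    have hy := y.isLt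
    rw [Matrix.map_apply, Matrix.sum_apply]
    simp only [Fin.sum_univ_succ, stencil, robinStencil, lcuCoeff, lcuUnitary, shift, reflFirst,
      reflLast, Matrix.diagonal_apply,
      Matrix.smul_apply, Matrix.mul_diagonal, Matrix.diagonal_mul, Matrix.transpose_apply,
      Matrix.one_apply, Fin.ext_iff, BoundaryOp.kind, Matrix.cons_val_zero, Matrix.cons_val_succ,
      Finset.univ_eq_empty, Finset.sum_empty, smul_eq_mul]
    generalize (x : ℕ) = a at *
    generalize (y : ℕ) = b at *
    generalize 2 ^ m = N at *
    generalize meshSize m .robin = h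
    split_ifs <;> first | (exfalso; omega) | (push_cast; ring)

end Terms

theorem ite_eq_ite_ite {β : Type*} {p q r : Prop} {_ : Decidable p} {_ : Decidable q}
    {_ : Decidable r}
    (h : r ↔ p ∧ q) (a b : β) :
    (if r then a else b) = if p then (if q then a else b) else b := by
  by_cases p <;> simp_all

/-! ### Circuits on the register and their cost -/

section Register

open Function Matrix

variable {d : ℕ} {n : Fin d → ℕ}

/-- The qubits of the direction `i`, least significant first. -/
def directionQubits (n : Fin d → ℕ) (i : Fin d) : List (Qubits n) :=
  List.ofFn fun k : Fin (n i) => ⟨i, Fin.rev k⟩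

theorem mem_directionQubits {i : Fin d} {q : Qubits n} :
    q ∈ directionQubits n i ↔ q.1 = i := by
  rw [directionQubits, List.mem_ofFn']
  constructor
  · rintro ⟨k, rfl⟩; rfl
  · obtain ⟨k, t⟩ := q
    rintro rfl
    exact ⟨Fin.rev t, by simp⟩

theorem length_directionQubits (i : Fin d) : (directionQubits n i).length = n i := by
  simp [directionQubits]

theorem nodup_directionQubits (i : Fin d) : (directionQubits n i).Nodup := by
  rw [directionQubits, List.nodup_ofFn]
  intro k l h
  simpa using h

theorem val_ofFn {Q : Type} {m : ℕ} (h : Fin m → Q) (f : Q → Fin 2) :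
    val (List.ofFn h) f = ∑ k, ((f (h k) : ℕ) : ℤ) * 2 ^ (k : ℕ) := by
  induction m with
  | zero => simp [val]
  | succ m ih =>
    rw [List.ofFn_succ, val, ih, Fin.sum_univ_succ, Finset.mul_sum]
    simp only [Fin.val_zero, pow_zero, mul_one, Fin.val_succ, pow_succ]
    congr 1
    exact Finset.sum_congr rfl fun _ _ => by ring

theorem basisEquiv_apply_val (f : Qubits n → Fin 2) (i : Fin d) :
    ((basisEquiv n f i : ℕ) : ℤ) = val (directionQubits n i) f := by
  rw [directionQubits, val_ofFn]
  -- Holds by unfolding `binary`: reversing the qubits puts the least significant one first.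
  have : (basisEquiv n f i : ℕ) = ∑ k : Fin (n i), (f ⟨i, Fin.rev k⟩ : ℕ) * 2 ^ (k : ℕ) := rfl
  rw [this]
  push_cast
  rfl

theorem basisEquiv_apply_eq_iff (f g : Qubits n → Fin 2) (i : Fin d) :
    basisEquiv n f i = basisEquiv n g i ↔ ∀ q : Qubits n, q.1 = i → f q = g q := by
  have h : basisEquiv n f i = basisEquiv n g i ↔
      val (directionQubits n i) f = val (directionQubits n i) g := by
    rw [← basisEquiv_apply_val, ← basisEquiv_apply_val, Fin.ext_iff]
    norm_cast
  rw [h]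
  constructor
  · intro h q hq
    exact eq_of_val_eq h q (mem_directionQubits.2 hq)
  · intro h
    exact val_congr fun q hq => h q (mem_directionQubits.1 hq)

theorem Implements.mul {C D : Circuit (Qubits n)}
    {U V : Matrix (∀ i, Fin (2 ^ n i)) (∀ i, Fin (2 ^ n i)) ℂ}
    (hC : Implements C U) (hD : Implements D V) : Implements (C ++ D) (U * V) := by
  rw [Implements] at *
  rw [← hC, ← hD, Circuit.matrix_append]
  simp only [reindex_apply, submatrix_mul_equiv]

theorem implements_nil : Implements ([] : Circuit (Qubits n)) 1 := by
  rw [Implements]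
  simp [Circuit.matrix]

/-- A circuit that increments the qubits of a direction performs a shift in that direction. -/
theorem Adds.implements_shift {i : Fin d} {C : Circuit (Qubits n)} (hC : Circuit.Reversible C)
    (h : Adds C (directionQubits n i) (fun _ => 1)) :
    Implements C (atSite (κ := fun i => Fin (2 ^ n i)) i (shift (n i))) := by
  rw [Implements]
  ext x y
  obtain ⟨g, rfl⟩ := (basisEquiv n).surjective x
  obtain ⟨f, rfl⟩ := (basisEquiv n).surjective y
  rw [reindex_apply, submatrix_apply, Equiv.symm_apply_apply, Equiv.symm_apply_apply,
    hC.matrix_apply, atSite_apply, shift]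
  have hg := basisEquiv_apply_val g i
  have hf := basisEquiv_apply_val f i
  have bg := (basisEquiv n g i).isLt
  have bf := (basisEquiv n f i).isLt
  have hlen := length_directionQubits (n := n) i
  have hd := h.dvd f
  rw [hlen] at hd
  refine ite_eq_ite_ite ⟨?_, ?_⟩ _ _
  · rintro rfl
    refine ⟨fun k hk => (basisEquiv_apply_eq_iff _ _ _).2 fun q hq => h.unchanged f q fun hq' =>
      hk (hq.symm.trans (mem_directionQubits.1 hq')), ?_⟩
    rw [← hg, ← hf] at hd
    generalize (basisEquiv n f i : ℕ) = a at *
    generalize (basisEquiv n (C.run f) i : ℕ) = b at *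
    by_cases ha : a + 1 = 2 ^ n i
    · right
      refine ⟨?_, ha⟩
      have ha' : (a : ℤ) + 1 = 2 ^ n i := by exact_mod_cast ha
      have : (b : ℤ) = 0 := eq_of_dvd_sub (N := 2 ^ n i) (by positivity) (by exact_mod_cast bg)
        le_rfl (by positivity) (by
          obtain ⟨k, hk⟩ := hd
          exact ⟨k + 1, by linear_combination hk + ha'⟩)
      exact_mod_cast this
    · left
      have hlt : a + 1 < 2 ^ n i := by omega
      have : (b : ℤ) = a + 1 := eq_of_dvd_sub (N := 2 ^ n i) (by positivity) (by exact_mod_cast bg)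
        (by positivity) (by exact_mod_cast hlt) hd
      exact_mod_cast this.symm
  · rintro ⟨hoff, hon⟩
    -- A basis state is determined by its qubits outside the direction and the residue encoded
    -- inside.
    refine eq_of_val_modEq (l := directionQubits n i) (fun q hq => ?_) ?_
    · rw [h.unchanged f q hq]
      exact (basisEquiv_apply_eq_iff _ _ q.1).1
        (hoff q.1 fun e => hq (mem_directionQubits.2 e)) q rfl
    · rw [hlen, ← hg]
      obtain ⟨k, hk⟩ := hd
      rw [← hf] at hk
      rcases hon with hon | ⟨h0, h1⟩
      · have : ((basisEquiv n f i : ℕ) : ℤ) + 1 = (basisEquiv n g i : ℕ) := by exact_mod_cast hon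
        exact ⟨-k, by linear_combination -hk - this⟩
      · have : ((basisEquiv n f i : ℕ) : ℤ) + 1 = 2 ^ n i := by exact_mod_cast h1
        rw [h0]
        exact ⟨-k - 1, by push_cast; linear_combination -hk - this⟩

theorem Implements.reverse {C : Circuit (Qubits n)} (hC : Circuit.Reversible C)
    {U : Matrix (∀ i, Fin (2 ^ n i)) (∀ i, Fin (2 ^ n i)) ℂ} (h : Implements C U) :
    Implements C.reverse U.transpose := by
  rw [Implements] at *
  rw [← h, hC.matrix_reverse]
  rfl

theorem implements_reflLast {i : Fin d} {C : Circuit (Qubits n)}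
    (h : Circuit.matrix C =
      diagonal fun x => if ∀ q ∈ directionQubits n i, x q = 1 then -1 else 1) :
    Implements C (atSite (κ := fun i => Fin (2 ^ n i)) i (reflLast (n i))) := by
  rw [Implements, h]
  ext x y
  obtain ⟨g, rfl⟩ := (basisEquiv n).surjective x
  obtain ⟨f, rfl⟩ := (basisEquiv n).surjective y
  have hlast : (∀ q ∈ directionQubits n i, g q = 1) ↔ (basisEquiv n g i : ℕ) + 1 = 2 ^ n i := by
    rw [← val_eq_max_iff, ← basisEquiv_apply_val, length_directionQubits, eq_sub_iff_add_eq]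
    norm_cast
  rw [reindex_apply, submatrix_apply, Equiv.symm_apply_apply, Equiv.symm_apply_apply,
    atSite_apply, reflLast, diagonal_apply, diagonal_apply, ← if_congr hlast rfl rfl]
  refine ite_eq_ite_ite ⟨?_, ?_⟩ _ _
  · rintro rfl
    exact ⟨fun _ _ => rfl, rfl⟩
  · rintro ⟨h1, h2⟩
    refine (basisEquiv n).injective (funext fun k => ?_)
    by_cases hk : k = i
    · exact hk ▸ h2
    · exact h1 k hk

/-- `U` is the operator of a circuit without `Z` gates, with at most `h` Hadamard gates and at
most `N` classical gates. -/
def HasCost (U : Matrix (∀ i, Fin (2 ^ n i)) (∀ i, Fin (2 ^ n i)) ℂ) (h N : ℕ) : Prop :=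
  ∃ C : Circuit (Qubits n), Implements C U ∧ C.numZ = 0 ∧ C.numH ≤ h ∧ C.numClassical ≤ N

theorem HasCost.mul {U V : Matrix (∀ i, Fin (2 ^ n i)) (∀ i, Fin (2 ^ n i)) ℂ} {h h' N N' : ℕ}
    (hU : HasCost U h N) (hV : HasCost V h' N') : HasCost (U * V) (h + h') (N + N') := by
  obtain ⟨C, hC, hZ, hH, hN⟩ := hU
  obtain ⟨D, hD, hZ', hH', hN'⟩ := hV
  refine ⟨C ++ D, hC.mul hD, ?_, ?_, ?_⟩ <;>
    simp only [Circuit.numZ, Circuit.numH, Circuit.numClassical, List.countP_append] at * <;> omega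

theorem HasCost.mono {U : Matrix (∀ i, Fin (2 ^ n i)) (∀ i, Fin (2 ^ n i)) ℂ} {h h' N N' : ℕ}
    (hU : HasCost U h N) (hh : h ≤ h') (hN : N ≤ N') : HasCost U h' N' := by
  obtain ⟨C, hC, hZ, hH, hN'⟩ := hU
  exact ⟨C, hC, hZ, hH.trans hh, hN'.trans hN⟩

theorem Circuit.Reversible.numZ_eq_zero {Q : Type} {C : Circuit Q} (hC : Circuit.Reversible C) :
    Circuit.numZ C = 0 := by
  rw [Circuit.numZ, List.countP_eq_zero]
  intro g hg
  have := hC g hg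
  cases g <;> simp_all [Gate.isClassical, Gate.isZ]

theorem Circuit.Reversible.numH_eq_zero {Q : Type} {C : Circuit Q} (hC : Circuit.Reversible C) :
    Circuit.numH C = 0 := by
  rw [Circuit.numH, List.countP_eq_zero]
  intro g hg
  have := hC g hg
  cases g <;> simp_all [Gate.isClassical, Gate.isH]

theorem HasCost.of_reversible {C : Circuit (Qubits n)} (hC : Circuit.Reversible C)
    {U : Matrix (∀ i, Fin (2 ^ n i)) (∀ i, Fin (2 ^ n i)) ℂ} (h : Implements C U) {N : ℕ}
    (hN : C.length ≤ N) : HasCost U 0 N :=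
  ⟨C, h, hC.numZ_eq_zero, hC.numH_eq_zero.le, List.countP_le_length.trans hN⟩

/-- Here `d ≥ 2` enters: another direction exists, and it has at least three qubits to lend. -/
theorem exists_borrowed (hd : 2 ≤ d) (hn : ∀ i, 2 < n i) (i : Fin d) :
    ∃ b e₁ e₂ : Qubits n, (b :: e₁ :: e₂ :: directionQubits n i).Nodup := by
  obtain ⟨j, hj⟩ : ∃ j : Fin d, j ≠ i := by
    have : Nontrivial (Fin d) := Fin.nontrivial_iff_two_le.2 hd
    exact exists_ne i
  have h := hn j
  refine ⟨⟨j, 0, by omega⟩, ⟨j, 1, by omega⟩, ⟨j, 2, by omega⟩, ?_⟩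
  simp [mem_directionQubits, hj, nodup_directionQubits]

theorem exists_increment_direction (hd : 2 ≤ d) (hn : ∀ i, 2 < n i) (i : Fin d) :
    ∃ C : Circuit (Qubits n), Circuit.Reversible C ∧ C.length ≤ 100 * (n i + 1) ∧
      Adds C (directionQubits n i) (fun _ => 1) := by
  obtain ⟨b, e₁, e₂, h⟩ := exists_borrowed hd hn i
  simpa [length_directionQubits] using exists_increment _ b e₁ e₂ h

theorem hasCost_shift (hd : 2 ≤ d) (hn : ∀ i, 2 < n i) (i : Fin d) :
    HasCost (atSite (κ := fun i => Fin (2 ^ n i)) i (shift (n i))) 0 (100 * (n i + 1)) := by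
  obtain ⟨C, hC, hl, h⟩ := exists_increment_direction hd hn i
  exact HasCost.of_reversible hC (h.implements_shift hC) hl

theorem hasCost_shift_transpose (hd : 2 ≤ d) (hn : ∀ i, 2 < n i) (i : Fin d) :
    HasCost (atSite (κ := fun i => Fin (2 ^ n i)) i (shift (n i)).transpose) 0
      (100 * (n i + 1)) := by
  obtain ⟨C, hC, hl, h⟩ := exists_increment_direction hd hn i
  rw [← atSite_transpose]
  exact HasCost.of_reversible hC.reverse ((h.implements_shift hC).reverse hC) (by simpa using hl)

theorem hasCost_reflLast (hd : 2 ≤ d) (hn : ∀ i, 2 < n i) (i : Fin d) :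
    HasCost (atSite (κ := fun i => Fin (2 ^ n i)) i (reflLast (n i))) 2
      (200 * (n i + 1)) := by
  obtain ⟨C, hC, hl, h⟩ := exists_increment_direction hd hn i
  obtain ⟨b, e₁, e₂, hb⟩ := exists_borrowed hd hn i
  have hlen := length_directionQubits (n := n) i
  -- The target `t` is the most significant qubit, the one that the carry out of `l` reaches.
  obtain ⟨l, t, hlt⟩ : ∃ l t, directionQubits n i = l ++ [t] :=
    (List.eq_nil_or_concat' _).resolve_left fun h0 => by
      have := hn i
      rw [h0] at hlen
      simp at hlen
      omega
  have ht : t ∉ l := by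
    have := nodup_directionQubits (n := n) i
    rw [hlt, List.nodup_append] at this
    exact fun h => this.2.2 t h t (by simp) rfl
  obtain ⟨D, hD, hDl, h'⟩ := exists_increment l b e₁ e₂ (hb.sublist (by
    rw [hlt]
    exact (((List.sublist_append_left l [t]).cons_cons _).cons_cons _).cons_cons _))
  rw [hlt] at h hlen
  have hrev := hD.reverse.append hC
  have hm := Flips.matrix_hadamard_conj hrev ht (Adds.flips ht h h')
  rw [← hlt] at hm
  refine ⟨_, implements_reflLast hm, ?_, ?_, ?_⟩
  · simpa [Circuit.numZ, Gate.isZ] using hrev.numZ_eq_zero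
  · have h2 : Circuit.numH ([Gate.H t] ++ (D.reverse ++ C) ++ [Gate.H t]) =
        Circuit.numH (D.reverse ++ C) + 2 := by
      simp only [Circuit.numH, List.countP_append, List.countP_cons, List.countP_nil, Gate.isH,
        if_true]
      omega
    rw [h2, hrev.numH_eq_zero]
  · have : Circuit.numClassical (D.reverse ++ C) ≤ _ := List.countP_le_length
    simp only [Circuit.numClassical, List.countP_append, List.length_append,
      List.length_reverse, List.length_singleton] at this hlen ⊢
    simp [Gate.isClassical] at this ⊢
    omega

theorem hasCost_reflFirst (hd : 2 ≤ d) (hn : ∀ i, 2 < n i) (i : Fin d) :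
    HasCost (atSite (κ := fun i => Fin (2 ^ n i)) i (reflFirst (n i))) 2
      (400 * (n i + 1)) := by
  rw [reflFirst_eq, atSite_mul, atSite_mul]
  exact (((hasCost_shift hd hn i).mul (hasCost_reflLast hd hn i)).mul
    (hasCost_shift_transpose hd hn i)).mono (by omega) (by omega)

/-- The most expensive terms multiply `reflFirst` by a shift, at cost `400 + 100` per unit of `n i +
1`; a single reflection accounts for the two Hadamard gates. -/
theorem hasCost_lcuUnitary (hd : 2 ≤ d) (hn : ∀ i, 2 < n i) (i : Fin d)
    (k : BoundaryKind) (j : Fin (numTerms k)) :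
    HasCost (atSite (κ := fun i => Fin (2 ^ n i)) i (lcuUnitary k (n i) j)) 2
      (500 * (n i + 1)) := by
  have hS := hasCost_shift hd hn i
  have hT := hasCost_shift_transpose hd hn i
  have h0 := hasCost_reflFirst hd hn i
  have h1 := hasCost_reflLast hd hn i
  have hI : HasCost (atSite (κ := fun i => Fin (2 ^ n i)) i 1) 0 0 := by
    rw [atSite_one]
    exact ⟨[], implements_nil, rfl, le_rfl, le_rfl⟩
  have cS := hS.mono (h' := 2) (N' := 500 * (n i + 1)) (by omega) (by omega)
  have cT := hT.mono (h' := 2) (N' := 500 * (n i + 1)) (by omega) (by omega)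
  have c0 := h0.mono (h' := 2) (N' := 500 * (n i + 1)) (by omega) (by omega)
  have c1 := h1.mono (h' := 2) (N' := 500 * (n i + 1)) (by omega) (by omega)
  have cI := hI.mono (h' := 2) (N' := 500 * (n i + 1)) (by omega) (by omega)
  have c0S := (h0.mul hS).mono (h' := 2) (N' := 500 * (n i + 1)) (by omega) (by omega)
  have c1S := (h1.mul hS).mono (h' := 2) (N' := 500 * (n i + 1)) (by omega) (by omega)
  have cT0 := (hT.mul h0).mono (h' := 2) (N' := 500 * (n i + 1)) (by omega) (by omega)
  have c0T := (h0.mul hT).mono (h' := 2) (N' := 500 * (n i + 1)) (by omega) (by omega)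
  rw [← atSite_mul] at c0S c1S cT0 c0T
  cases k <;> fin_cases j
  exacts [cI, cS, c0S, cT, cT0, cI, cS, cT, cI, cS, c0S, c1S, cT, cT0, c0T, c0, c1, cI]

end Register

end PoissonLCU

open PoissonLCU
theorem theorem3 :
    ∃ (K : ℕ)
      (R : ∀ (k : BoundaryKind) (m : ℕ), Fin (numTerms k) → Matrix (Fin (2 ^ m)) (Fin (2 ^ m)) ℂ)
      (c : ∀ (b : BoundaryOp) (_ : ℕ), Fin (numTerms b.kind) → ℝ),
      -- one-dimensional decompositions of the matrices `A_{m,b}` into unitaries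
      (∀ (b : BoundaryOp) (m : ℕ), 2 < m →
        (∀ j, R b.kind m j ∈ Matrix.unitaryGroup (Fin (2 ^ m)) ℂ) ∧
        normalized1D m b = ∑ j, (c b m j : ℂ) • R b.kind m j) ∧
      -- the decomposition of the `d`-dimensional operator and the cost of its terms
      (∀ (d : ℕ), 2 ≤ d → ∀ (n : Fin d → ℕ), (∀ i, 2 < n i) → ∀ (α : Fin d → BoundaryOp),
        laplacian n α =
          ∑ i, ∑ j, ((c (α i) (n i) j / meshSize (n i) (α i).kind ^ 2 : ℝ) : ℂ) •
            atSite (κ := fun i => Fin (2 ^ n i)) i (R (α i).kind (n i) j) ∧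
        (∀ i, numTerms (α i).kind ≤ 10) ∧
        ∀ (i : Fin d) (j : Fin (numTerms (α i).kind)),
          atSite (κ := fun i => Fin (2 ^ n i)) i (R (α i).kind (n i) j) ∈
            Matrix.unitaryGroup (∀ i, Fin (2 ^ n i)) ℂ ∧
          ∃ C : Circuit (Qubits n),
            Implements C (atSite (κ := fun i => Fin (2 ^ n i)) i (R (α i).kind (n i) j)) ∧
            C.numZ ≤ 1 ∧ C.numH ≤ 2 ∧
            C.numClassical ≤ K * Finset.univ.sup n) := by
  -- `500 * (n i + 1) ≤ 1000 * n i` because `n i ≥ 1`.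
  refine ⟨1000, lcuUnitary, lcuCoeff, fun b m hm =>
    ⟨lcuUnitary_mem_unitaryGroup _ _, normalized1D_eq_sum hm b⟩, ?_⟩
  intro d hd n hn α
  refine ⟨?_, fun i => by cases (α i).kind <;> simp [numTerms], fun i j =>
    ⟨atSite_mem_unitaryGroup (κ := fun i => Fin (2 ^ n i)) (lcuUnitary_mem_unitaryGroup _ _ j),
      ?_⟩⟩
  · refine Finset.sum_congr rfl fun i _ => ?_
    have hh := meshSize_ne_zero (hn i) (α i).kind
    have e : laplacian1D (n i) (α i) =
        ∑ j, ((lcuCoeff (α i) (n i) j / meshSize (n i) (α i).kind ^ 2 : ℝ) : ℂ) •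
          lcuUnitary (α i).kind (n i) j := by
      have h1 : laplacian1D (n i) (α i) =
          ((meshSize (n i) (α i).kind ^ 2 : ℝ) : ℂ)⁻¹ • normalized1D (n i) (α i) := by
        rw [normalized1D, smul_smul, inv_mul_cancel₀, one_smul]
        exact Complex.ofReal_ne_zero.2 (pow_ne_zero 2 hh)
      rw [h1, normalized1D_eq_sum (hn i), Finset.smul_sum]
      refine Finset.sum_congr rfl fun j _ => ?_
      rw [smul_smul, Complex.ofReal_div, div_eq_inv_mul]
    rw [e, atSite_sum (κ := fun i => Fin (2 ^ n i))]
    exact Finset.sum_congr rfl fun j _ => atSite_smul (κ := fun i => Fin (2 ^ n i)) i _ _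
  · obtain ⟨C, hC, hZ, hH, hN⟩ := hasCost_lcuUnitary hd hn i (α i).kind j
    refine ⟨C, hC, by omega, hH, hN.trans ?_⟩
    have h1 : n i ≤ Finset.univ.sup n := Finset.le_sup (Finset.mem_univ i)
    have h2 := hn i
    omega
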